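/- **Rules and programs.** Atoms are $r(t_1,\dots,t_n)$ for a predicate symbol $r$, or $t_1=t_2$, with terms $t_i$ of a first-order language; a literal is $a$ or $\mathit{not}\ a$ for an atom $a$. An aggregate expression is $b\le \#\mathit{count}\{\mathbf z: L_1,\dots,L_k\}$ with $b,k\ge 1$, $\mathbf z$ a (possibly empty) list of distinct variables and $L_i$ literals. A RASPL-1 rule is $a_1\mid\dots\mid a_l\leftarrow \mathit{Body}$ ($l\ge 0$) or $\{a_1\}\leftarrow \mathit{Body}$, where the $a_i$ are atoms and $\mathit{Body}$ is a finite set of expressions $e$ or $\mathit{not}\ e$, with $e$ an atom or an aggregate expression. A program is a finite set of rules. The first-order representation $\hat\Pi$ of a program $\Pi$ is the conjunction of the universal closures of $\mathit{Body}\to a_1\vee\dots\vee a_l$ (which is $\mathit{Body}\to\bot$ for $l=0$), respectively $\neg\neg a_1\wedge \mathit{Body}\to a_1$, for its rules. Here comma and $\mathit{not}$ are read as $\wedge$ and $\neg$, and $b\le\#\mathit{count}\{\mathbf z:F(\mathbf z)\}$ is read as $\exists \mathbf z^1\cdots\mathbf z^b\big(\bigwedge_{i}F(\mathbf z^i)\wedge\bigwedge_{i<j}\neg(\mathbf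 z^i=\mathbf z^j)\big)$ with lists $\mathbf z^i$ of new variables. **Stable models.** For a first-order sentence $F$ and a finite tuple $\mathbf p$ of distinct predicate symbols (not including equality), $\mathrm{SM}_{\mathbf p}[F]$ is the second-order sentence $F\wedge\neg\exists\mathbf v\,\big((\mathbf v<\mathbf p)\wedge F^*(\mathbf v)\big)$. Here $\mathbf v$ is a tuple of predicate variables corresponding to $\mathbf p$; $\mathbf v<\mathbf p$ means that $\mathbf v\le\mathbf p$ (componentwise inclusion) and not $\mathbf p\le\mathbf v$; $\neg G$ is $G\to\bot$; and $F^*(\mathbf v)$ is defined recursively: $p_i(\mathbf t)^*=v_i(\mathbf t)$, other atomic formulas (equalities and $\bot$ included) are unchanged, $^*$ commutes with $\wedge,\vee,\forall,\exists$, and $(G\to H)^*=(G^*\to H^*)\wedge(G\to H)$. By $\sigma(F)$ we denote the set of function and predicate symbols (equality excluded) occurring in $F$. **Projection.** Let $R=(H\leftarrow\mathit{Body})$ be a rule, and let $\mathbf x$ be a non-empty tuple of variables that occur in literals of $\mathit{Body}$, and occur neither in aggregate expressions of $\mathit{Body}$ nor in $H$. Let $\alpha$ be a set of literals of $\mathit{Body}$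 that includes all literals of $\mathit{Body}$ containing a variable from $\mathbf x$; let $\mathbf y$ be a tuple, without repetitions, of all variables that occur in $\alpha$ and are not in $\mathbf x$; let $\alpha'$ be any subset of $\alpha$ whose literals contain no variable from $\mathbf x$; and let $u$ be a predicate symbol whose arity is the length of $\mathbf y$. The two rules $$H\leftarrow(\mathit{Body}\setminus\alpha)\cup\alpha'\cup\{u(\mathbf y)\},\qquad u(\mathbf y)\leftarrow\alpha$$ are then called a *result of projecting $\mathbf x$ out of $R$ using $u$*. **Theorem.** Let $R$ be a rule of a program $\Pi$, let $\mathbf x$ be a non-empty tuple of variables that occur only in the body of $R$, outside of all aggregate expressions, and not in the head, and let $u$ be a predicate symbol not in $\sigma(\hat\Pi)$. Let $\Pi'$ be obtained from $\Pi$ by replacing $R$ with a result of projecting $\mathbf x$ out of $R$ using $u$. Then, for every tuple $\mathbf p$ of predicate symbols from $\sigma(\hat\Pi)$, $\sigma(\hat\Pi)\subseteq\sigma(\hat\Pi')$ and $M\mapsto M|_{\sigma(\hat\Pi)}$ is a 1-1 correspondence between the models of $\mathrm{SM}_{\mathbf p,u}[\hat\Pi']$ (interpretations over $\sigma(\hat\Pi')$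 with non-empty universe) and the models of $\mathrm{SM}_{\mathbf p}[\hat\Pi]$ (interpretations over $\sigma(\hat\Pi)$ with non-empty universe). -/

import Mathlib

universe a b c w

namespace RASPL

noncomputable section

/-- First-order formulas with named variables (natural numbers), over the function symbols of `L`
and a family `P` of predicate symbols (or predicate variables) of each arity. The primitives are
falsity, equality, predicate atoms, conjunction, disjunction, implication and both quantifiers. -/
inductive Formula (L : FirstOrder.Language.{a, b}) (P : ℕ → Type c) : Type (max a c)
  | bot : Formula L P
  | eq (t s : L.Term ℕ) : Formula L P
  | pred {n : ℕ} (R : P n) (ts : Fin n → L.Term ℕ) : Formula L P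
  | and (F G : Formula L P) : Formula L P
  | or (F G : Formula L P) : Formula L P
  | imp (F G : Formula L P) : Formula L P
  | all (x : ℕ) (F : Formula L P) : Formula L P
  | ex (x : ℕ) (F : Formula L P) : Formula L P

/-- First-order formulas in the language `L`. -/
abbrev FOFormula (L : FirstOrder.Language.{a, b}) := Formula L L.Relations

namespace Formula

variable {L : FirstOrder.Language.{a, b}} {P : ℕ → Type c}

def neg (F : Formula L P) : Formula L P := imp F bot

def top : Formula L P := imp bot bot

/-- Finite conjunction. -/
def conj (l : List (Formula L P)) : Formula L P := l.foldr and top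

/-- Finite disjunction. -/
def disj (l : List (Formula L P)) : Formula L P := l.foldr or bot

/-- Existential quantification over a list of variables. -/
def exs (xs : List ℕ) (F : Formula L P) : Formula L P := xs.foldr ex F

/-- Universal quantification over a list of variables. -/
def alls (xs : List ℕ) (F : Formula L P) : Formula L P := xs.foldr all F

def freeVars : Formula L P → Finset ℕ
  | bot => ∅
  | eq t s => t.varFinset ∪ s.varFinset
  | pred _ ts => Finset.univ.biUnion fun i => (ts i).varFinset
  | and F G => F.freeVars ∪ G.freeVars
  | or F G => F.freeVars ∪ G.freeVars
  | imp F G => F.freeVars ∪ G.freeVars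
  | all x F => F.freeVars.erase x
  | ex x F => F.freeVars.erase x

/-- Universal closure. -/
def closure (F : Formula L P) : Formula L P := alls F.freeVars.toList F

/-- Satisfaction of a formula under the variable assignment `v`, where the function symbols are
interpreted by the structure `S` and the members of `P` by `I`. -/
def Sat {D : Type w} (S : L.Structure D) (I : ∀ n, P n → (Fin n → D) → Prop) :
    (ℕ → D) → Formula L P → Prop
  | _, bot => False
  | v, eq t s => t.realize v = s.realize v
  | v, pred R ts => I _ R fun i => (ts i).realize v
  | v, and F G => Sat S I v F ∧ Sat S I v G
  | v, or F G => Sat S I v F ∨ Sat S I v G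
  | v, imp F G => Sat S I v F → Sat S I v G
  | v, all x F => ∀ d : D, Sat S I (Function.update v x d) F
  | v, ex x F => ∃ d : D, Sat S I (Function.update v x d) F

/-- Formulas that may contain, besides the predicate constants `R` of `L` (written `Sum.inl R`),
one predicate variable `Sum.inr R` for each `R`. -/
abbrev WithPredVars (L : FirstOrder.Language.{a, b}) := Formula L fun n => L.Relations n ⊕ L.Relations n

/-- A first-order formula, seen as a formula without predicate variables. -/
def lift : FOFormula L → WithPredVars L
  | bot => bot
  | eq t s => eq t s
  | pred R ts => pred (Sum.inl R) ts
  | and F G => and F.lift G.lift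
  | or F G => or F.lift G.lift
  | imp F G => imp F.lift G.lift
  | all x F => all x F.lift
  | ex x F => ex x F.lift

open Classical in
/-- The transformation `F ↦ F*(u)` relative to the predicate constants `p`. -/
def star (p : Finset (Σ n, L.Relations n)) : FOFormula L → WithPredVars L
  | bot => bot
  | eq t s => eq t s
  | pred (n := n) R ts =>
      if (⟨n, R⟩ : Σ n, L.Relations n) ∈ p then pred (Sum.inr R) ts else pred (Sum.inl R) ts
  | and F G => and (F.star p) (G.star p)
  | or F G => or (F.star p) (G.star p)
  | imp F G => and (imp (F.star p) (G.star p)) (imp F.lift G.lift)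
  | all x F => all x (F.star p)
  | ex x F => ex x (F.star p)

end Formula

/-- A set of function symbols and (non-equality) predicate symbols of the ambient language `L`. -/
structure Signature (L : FirstOrder.Language.{a, b}) where
  funs : Set (Σ n, L.Functions n)
  preds : Set (Σ n, L.Relations n)

namespace Signature

variable {L : FirstOrder.Language.{a, b}}

/-- Inclusion of signatures. -/
def Sub (σ τ : Signature L) : Prop := σ.funs ⊆ τ.funs ∧ σ.preds ⊆ τ.preds

end Signature

/-- The function symbols (object constants included) occurring in a term. -/
def termFuns {L : FirstOrder.Language.{a, b}} : L.Term ℕ → Set (Σ n, L.Functions n)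
  | .var _ => ∅
  | .func (l := n) f ts => insert ⟨n, f⟩ (⋃ i, termFuns (ts i))

namespace Formula

variable {L : FirstOrder.Language.{a, b}}

/-- The function symbols occurring in a formula. -/
def funs : FOFormula L → Set (Σ n, L.Functions n)
  | bot => ∅
  | eq t s => termFuns t ∪ termFuns s
  | pred _ ts => ⋃ i, termFuns (ts i)
  | and F G => F.funs ∪ G.funs
  | or F G => F.funs ∪ G.funs
  | imp F G => F.funs ∪ G.funs
  | all _ F => F.funs
  | ex _ F => F.funs

/-- The predicate symbols (equality excluded) occurring in a formula. -/
def preds : FOFormula L → Set (Σ n, L.Relations n)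
  | bot => ∅
  | eq _ _ => ∅
  | pred (n := n) R _ => {⟨n, R⟩}
  | and F G => F.preds ∪ G.preds
  | or F G => F.preds ∪ G.preds
  | imp F G => F.preds ∪ G.preds
  | all _ F => F.preds
  | ex _ F => F.preds

/-- The signature `σ(F)` of a formula. -/
def sig (F : FOFormula L) : Signature L := ⟨F.funs, F.preds⟩

end Formula

/-- An interpretation over the signature `σ` with universe `D`: it assigns values to the symbols
in `σ` and to no others. -/
structure Interp {L : FirstOrder.Language.{a, b}} (σ : Signature L) (D : Type w) where
  fn : ∀ {n : ℕ} (f : L.Functions n), ⟨n, f⟩ ∈ σ.funs → (Fin n → D) → D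
  pr : ∀ {n : ℕ} (R : L.Relations n), ⟨n, R⟩ ∈ σ.preds → (Fin n → D) → Prop

namespace Interp

variable {L : FirstOrder.Language.{a, b}} {σ τ : Signature L} {D : Type w}

/-- The restriction of an interpretation over `τ` to a smaller signature `σ`. -/
def restrict (h : σ.Sub τ) (M : Interp τ D) : Interp σ D where
  fn f hf := M.fn f (h.1 hf)
  pr R hR := M.pr R (h.2 hR)

open Classical in
/-- The structure used to evaluate formulas whose symbols all belong to `σ`; what it says about
other symbols is immaterial for such formulas. -/
@[reducible] def total [Nonempty D] (M : Interp σ D) : L.Structure D where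
  funMap {n} f ds := if h : ⟨n, f⟩ ∈ σ.funs then M.fn f h ds else Classical.arbitrary D
  RelMap {n} R ds := ∃ h : ⟨n, R⟩ ∈ σ.preds, M.pr R h ds

/-- Satisfaction of a first-order formula. -/
def SatFO [Nonempty D] (M : Interp σ D) (v : ℕ → D) (F : FOFormula L) : Prop :=
  F.Sat M.total (fun _ R => M.total.RelMap R) v

/-- Satisfaction of a formula with predicate variables, where `U` is the value of the
predicate variables. -/
def SatPV [Nonempty D] (M : Interp σ D) (U : ∀ n, L.Relations n → (Fin n → D) → Prop)
    (v : ℕ → D) (F : Formula.WithPredVars L) : Prop :=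
  F.Sat M.total (fun n => Sum.elim (fun R => M.total.RelMap R) (U n)) v

/-- `u ≤ p`, for the value `U` of the predicate variables `u`. -/
def PredVarsLE [Nonempty D] (M : Interp σ D) (p : Finset (Σ n, L.Relations n))
    (U : ∀ n, L.Relations n → (Fin n → D) → Prop) : Prop :=
  ∀ R ∈ p, ∀ ds, U R.1 R.2 ds → M.total.RelMap R.2 ds

/-- `p ≤ u`, for the value `U` of the predicate variables `u`. -/
def PredVarsGE [Nonempty D] (M : Interp σ D) (p : Finset (Σ n, L.Relations n))
    (U : ∀ n, L.Relations n → (Fin n → D) → Prop) : Prop :=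
  ∀ R ∈ p, ∀ ds, M.total.RelMap R.2 ds → U R.1 R.2 ds

/-- `M` is a model of the second-order sentence
`SM_p[F] = F ∧ ¬∃ u ((u < p) ∧ F*(u))`, where `u < p` is `u ≤ p ∧ ¬ (p ≤ u)`. -/
def IsModelSM [Nonempty D] (M : Interp σ D) (p : Finset (Σ n, L.Relations n))
    (F : FOFormula L) : Prop :=
  ∀ v : ℕ → D, M.SatFO v F ∧
    ¬ ∃ U : ∀ n, L.Relations n → (Fin n → D) → Prop,
      (M.PredVarsLE p U ∧ ¬ M.PredVarsGE p U) ∧ M.SatPV U v (F.star p)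

end Interp

/-- Atoms, including equalities between terms. -/
inductive Atom (L : FirstOrder.Language.{a, b}) : Type (max a b)
  | pred {n : ℕ} (R : L.Relations n) (ts : Fin n → L.Term ℕ) : Atom L
  | eq (t s : L.Term ℕ) : Atom L

/-- An expression `e`, possibly preceded by `not`. -/
inductive Signed (X : Type c) : Type c
  | pos (e : X) : Signed X
  | neg (e : X) : Signed X

/-- The expression without `not`. -/
def Signed.expr {X : Type c} : Signed X → X
  | .pos e => e
  | .neg e => e

/-- The first-order representation of `e` or `not e`, given that of `e`. -/
def Signed.fol {L : FirstOrder.Language.{a, b}} {X : Type c} (f : X → FOFormula L) : Signed X → FOFormula L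
  | .pos e => f e
  | .neg e => (f e).neg

namespace Atom

variable {L : FirstOrder.Language.{a, b}}

def fol : Atom L → FOFormula L
  | pred R ts => .pred R ts
  | eq t s => .eq t s

/-- The variables occurring in an atom. -/
def vars : Atom L → Finset ℕ
  | pred _ ts => Finset.univ.biUnion fun i => (ts i).varFinset
  | eq t s => t.varFinset ∪ s.varFinset

/-- Replacement of each variable `x` by the variable `ρ x`. -/
def rename (ρ : ℕ → ℕ) : Atom L → Atom L
  | pred R ts => pred R fun i => (ts i).relabel ρ
  | eq t s => eq (t.relabel ρ) (s.relabel ρ)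

end Atom

/-- The aggregate expression `bound ≤ #count{aggVars : lits}`. -/
structure Aggregate (L : FirstOrder.Language.{a, b}) where
  bound : ℕ
  bound_pos : 0 < bound
  aggVars : List ℕ
  aggVars_nodup : aggVars.Nodup
  lits : List (Signed (Atom L))
  lits_ne_nil : lits ≠ []

namespace Aggregate

variable {L : FirstOrder.Language.{a, b}}

/-- All variables occurring in the aggregate expression, the aggregate variables included. -/
def vars (A : Aggregate L) : Finset ℕ :=
  A.aggVars.toFinset ∪ A.lits.foldr (fun l s => l.expr.vars ∪ s) ∅

/-- The `j`-th member of the `i`-th list of new variables. -/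
def newVar (A : Aggregate L) (i j : ℕ) : ℕ :=
  (A.vars.sup id + 1) + i * A.aggVars.length + j

/-- The `i`-th list of new variables, of the same length as the list of aggregate variables. -/
def newVars (A : Aggregate L) (i : ℕ) : List ℕ :=
  (List.range A.aggVars.length).map (A.newVar i)

/-- The renaming of the aggregate variables to the `i`-th list of new variables. -/
def renamingFn (A : Aggregate L) (i : ℕ) (x : ℕ) : ℕ :=
  if x ∈ A.aggVars then A.newVar i (A.aggVars.idxOf x) else x

/-- The conjunction of the literals with the aggregate variables replaced by the `i`-th list of
new variables. -/
def inst (A : Aggregate L) (i : ℕ) : FOFormula L :=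
  Formula.conj (A.lits.map (Signed.fol fun a => (a.rename (A.renamingFn i)).fol))

/-- Equality of the `i`-th and the `j`-th list of new variables. -/
def eqLists (A : Aggregate L) (i j : ℕ) : FOFormula L :=
  Formula.conj ((List.range A.aggVars.length).map fun k =>
    .eq (.var (A.newVar i k)) (.var (A.newVar j k)))

/-- The first-order representation
`∃ x¹ ⋯ xᵇ (⋀ᵢ F(xⁱ) ∧ ⋀_{i < j} ¬ (xⁱ = xʲ))` (with indices starting at `0`). -/
def fol (A : Aggregate L) : FOFormula L :=
  Formula.exs ((List.range A.bound).flatMap A.newVars)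
    (.and
      (Formula.conj ((List.range A.bound).map A.inst))
      (Formula.conj ((List.range A.bound).flatMap fun j =>
        (List.range j).map fun i => (A.eqLists i j).neg)))

end Aggregate

/-- Expressions that occur in bodies, possibly preceded by `not`. -/
inductive BodyExpr (L : FirstOrder.Language.{a, b}) : Type (max a b)
  | atom (a : Atom L) : BodyExpr L
  | agg (A : Aggregate L) : BodyExpr L

namespace BodyExpr

variable {L : FirstOrder.Language.{a, b}}

def fol : BodyExpr L → FOFormula L
  | atom a => a.fol
  | agg A => A.fol

def vars : BodyExpr L → Finset ℕ
  | atom a => a.vars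
  | agg A => A.vars

def IsAtom : BodyExpr L → Prop
  | atom _ => True
  | agg _ => False

end BodyExpr

/-- The elements of bodies: `e` or `not e`, where `e` is an atom or an aggregate expression. -/
abbrev BodyElem (L : FirstOrder.Language.{a, b}) := Signed (BodyExpr L)

namespace BodyElem

variable {L : FirstOrder.Language.{a, b}}

/-- The element is an atom or `not` followed by an atom. -/
def IsLiteral (e : BodyElem L) : Prop := (Signed.expr e).IsAtom

def vars (e : BodyElem L) : Finset ℕ := (Signed.expr e).vars

end BodyElem

/-- Bodies, identified with the finite set of their elements. -/
abbrev Body (L : FirstOrder.Language.{a, b}) := Finset (BodyElem L)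

def bodyFol {L : FirstOrder.Language.{a, b}} (B : Body L) : FOFormula L :=
  Formula.conj (B.toList.map (Signed.fol BodyExpr.fol))

/-- Heads: a disjunction `a₁ ∣ ⋯ ∣ aₗ` with `l ≥ 0`, or a choice expression `{a}`. -/
inductive Head (L : FirstOrder.Language.{a, b}) : Type (max a b)
  | disj (as : List (Atom L)) : Head L
  | choice (a : Atom L) : Head L

/-- The atoms of a head. -/
def Head.atoms {L : FirstOrder.Language.{a, b}} : Head L → List (Atom L)
  | .disj as => as
  | .choice a => [a]

/-- Rules of RASPL-1. -/
structure Rule (L : FirstOrder.Language.{a, b}) where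
  head : Head L
  body : Body L

/-- The first-order representation of a rule: the universal closure of `Body → a₁ ∨ ⋯ ∨ aₗ`,
or of `¬¬a ∧ Body → a`. -/
def Rule.fol {L : FirstOrder.Language.{a, b}} (R : Rule L) : FOFormula L :=
  match R.head with
  | .disj as => (Formula.imp (bodyFol R.body) (Formula.disj (as.map Atom.fol))).closure
  | .choice a => (Formula.imp (.and a.fol.neg.neg (bodyFol R.body)) a.fol).closure

/-- Programs: finite sets of rules. -/
abbrev Program (L : FirstOrder.Language.{a, b}) := Finset (Rule L)

/-- The first-order representation of a program: the conjunction of those of its rules. -/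
def Program.fol {L : FirstOrder.Language.{a, b}} (Pr : Program L) : FOFormula L :=
  Formula.conj (Pr.toList.map Rule.fol)

/-- The members of `xs` are variables that occur in the body of `R` outside of aggregate
expressions, and occur neither in aggregate expressions of the body nor in the head. -/
structure OnlyInBodyLiterals {L : FirstOrder.Language.{a, b}} (R : Rule L) (xs : List ℕ) : Prop where
  occurs : ∀ x ∈ xs, ∃ e ∈ R.body, BodyElem.IsLiteral e ∧ x ∈ BodyElem.vars e
  not_in_aggregates :
    ∀ x ∈ xs, ∀ e ∈ R.body, ¬ BodyElem.IsLiteral e → x ∉ BodyElem.vars e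
  not_in_head : ∀ x ∈ xs, ∀ A ∈ R.head.atoms, x ∉ A.vars

/-- The atom `u(y)`. -/
def varAtom {L : FirstOrder.Language.{a, b}} {n : ℕ} (u : L.Relations n) (y : Fin n → ℕ) : Atom L :=
  .pred u fun i => .var (y i)

open Classical in
/-- The rules `R₁`, `R₂` are a result of projecting the variables `xs` out of `R` using `u`:
`R₁` is `H ← (Body ∖ α) ∪ α' ∪ {u(y)}` and `R₂` is `u(y) ← α`. Here `α` is a set of literals of
the body that includes all those containing a member of `xs`, `α' ⊆ α` consists of literals
without variables from `xs`, and `y` is the tuple of all variables of `α` not in `xs`. -/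
def IsProjection {L : FirstOrder.Language.{a, b}} (R : Rule L) (xs : List ℕ) {n : ℕ} (u : L.Relations n)
    (R₁ R₂ : Rule L) : Prop :=
  ∃ (α α' : Body L) (y : Fin n → ℕ),
    α ⊆ R.body ∧
    (∀ e ∈ α, BodyElem.IsLiteral e) ∧
    (∀ e ∈ R.body, BodyElem.IsLiteral e → (∃ x ∈ xs, x ∈ BodyElem.vars e) → e ∈ α) ∧
    α' ⊆ α ∧
    (∀ e ∈ α', ∀ x ∈ xs, x ∉ BodyElem.vars e) ∧
    Function.Injective y ∧
    (∀ z, z ∈ Set.range y ↔ (∃ e ∈ α, z ∈ BodyElem.vars e) ∧ z ∉ xs) ∧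
    R₁ = ⟨R.head, (R.body \ α) ∪ α' ∪ {.pos (.atom (varAtom u y))}⟩ ∧
    R₂ = ⟨.disj [varAtom u y], α⟩

open Classical in
/-- The program in which the rule `R` is replaced by the rules `R₁` and `R₂`. -/
def Program.replace {L : FirstOrder.Language.{a, b}} (Pr : Program L) (R R₁ R₂ : Rule L) : Program L :=
  (Pr \ {R}) ∪ {R₁, R₂}

open Classical in
/-- The tuple of predicate symbols `p` (given as a finite set) extended with `u`. -/
def extendPreds {L : FirstOrder.Language.{a, b}} (p : Finset (Σ n, L.Relations n)) {n : ℕ}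
    (u : L.Relations n) : Finset (Σ n, L.Relations n) :=
  insert ⟨n, u⟩ p

end

end RASPL

namespace RASPL

open FirstOrder

variable {L : FirstOrder.Language.{a, b}} {D : Type w}

/-! Evaluating F* amounts to evaluating F in the logic of here-and-there: the predicate variables
give the "here" world J, and M itself gives the "there" world I (`sat_star`). So a model of SM is an
I that satisfies the program and is minimal among the here-worlds J ≤ I that agree with I off p
(`Interp.isModelSM_iff_stable`).

The rule u(y) ← α says that u contains the projection of α onto y, that is, the tuples y for which
some values of the remaining variables satisfy α. If u contains this projection, the projected rule
entails R. If u is contained in it, R entails the projected rule, because the projected variables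
occur in no part of R outside α (`holds_of_projectedRule`, `holds_projectedRule`).

Minimality forces u to equal the projection (`Program.Stable.eq_projection`), so u is determined by
the rest of the model, which gives injectivity. Stability passes in both directions by matching
here-worlds. One for Π is expanded by its own projection, which stays below I because here-truth
implies there-truth (`HSat.sat`). One for Π' yields one for Π once u is disregarded
(`Program.Stable.of_projectedProgram`, `Program.Stable.projectedProgram`). -/

/-- Interpretations of all predicate symbols of `L` in the universe `D`. -/
abbrev RelInterp (L : FirstOrder.Language.{a, b}) (D : Type w) : Type (max b w) :=
  ∀ n, L.Relations n → (Fin n → D) → Prop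

/-! ### Terms under change of structure, assignment and variables -/

theorem realize_congr {S S' : L.Structure D}
    (hS : ∀ n (f : L.Functions n) ds, S.funMap f ds = S'.funMap f ds) {v v' : ℕ → D}
    (t : L.Term ℕ) (hv : ∀ x ∈ t.varFinset, v x = v' x) :
    @Language.Term.realize L D S ℕ v t = @Language.Term.realize L D S' ℕ v' t := by
  induction t with
  | var x => exact hv x (by simp [Language.Term.varFinset])
  | func f ts ih =>
    simp only [Language.Term.realize]
    rw [hS]
    congr 1
    funext i
    exact ih i fun x hx => hv x (by
      simp only [Language.Term.varFinset, Finset.mem_biUnion]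
      exact ⟨i, Finset.mem_univ _, hx⟩)

theorem mem_varFinset_relabel (ρ : ℕ → ℕ) (t : L.Term ℕ) {x : ℕ}
    (hx : x ∈ (t.relabel ρ).varFinset) : ∃ z ∈ t.varFinset, ρ z = x := by
  induction t with
  | var z =>
    simp only [Language.Term.relabel, Language.Term.varFinset, Finset.mem_singleton] at hx
    exact ⟨z, by simp [Language.Term.varFinset], hx.symm⟩
  | func f ts ih =>
    simp only [Language.Term.relabel, Language.Term.varFinset, Finset.mem_biUnion] at hx ⊢
    obtain ⟨i, hi, hx⟩ := hx
    obtain ⟨z, hz, rfl⟩ := ih i hx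
    exact ⟨z, ⟨i, hi, hz⟩, rfl⟩

/-! ### Here-and-there satisfaction -/

namespace Formula

/-- Satisfaction in the logic of here-and-there, with `J` as the here and `I` as the there
interpretation of the predicate symbols. -/
def HSat (S : L.Structure D) (I J : RelInterp L D) : (ℕ → D) → FOFormula L → Prop
  | _, bot => False
  | v, eq t s => t.realize v = s.realize v
  | v, pred R ts => J _ R fun i => (ts i).realize v
  | v, and F G => HSat S I J v F ∧ HSat S I J v G
  | v, or F G => HSat S I J v F ∨ HSat S I J v G
  | v, imp F G => (HSat S I J v F → HSat S I J v G) ∧ (F.Sat S I v → G.Sat S I v)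
  | v, all x F => ∀ d : D, HSat S I J (Function.update v x d) F
  | v, ex x F => ∃ d : D, HSat S I J (Function.update v x d) F

/-- With equal worlds the two halves of the implication clause coincide. This lets classical truth
be handled as the case J = I of the here-and-there lemmas. -/
theorem hSat_self (S : L.Structure D) (I : RelInterp L D) (F : FOFormula L) (v : ℕ → D) :
    HSat S I I v F ↔ F.Sat S I v := by
  induction F generalizing v <;> simp_all [HSat, Sat]

theorem sat_lift (S : L.Structure D) (I U : RelInterp L D) (F : FOFormula L) (v : ℕ → D) :
    F.lift.Sat S (fun n => Sum.elim (I n) (U n)) v ↔ F.Sat S I v := by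
  induction F generalizing v <;> simp_all [lift, Sat]

-- The extra conjunct of * at implications is the there-world condition in `HSat`. Symbols outside p
-- stay constants, so their here-value is that of I and U is ignored on them.
open Classical in
theorem sat_star (S : L.Structure D) (I U : RelInterp L D)
    (p : Finset (Σ n, L.Relations n)) (F : FOFormula L) (v : ℕ → D) :
    (F.star p).Sat S (fun n => Sum.elim (I n) (U n)) v ↔
      HSat S I (fun n R => if ⟨n, R⟩ ∈ p then U n R else I n R) v F := by
  induction F generalizing v with
  | pred R ts => by_cases h : (⟨_, R⟩ : Σ n, L.Relations n) ∈ p <;> simp [star, HSat, Sat, h]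
  | _ => simp_all [star, HSat, Sat, sat_lift]

/-- Persistence. J ≤ I is needed only at atoms; the implication clause already contains its
classical reading. -/
theorem HSat.sat {S : L.Structure D} {I J : RelInterp L D}
    (hJ : ∀ n R ds, J n R ds → I n R ds) {F : FOFormula L} {v : ℕ → D}
    (h : HSat S I J v F) : F.Sat S I v := by
  induction F generalizing v with
  | bot => exact h
  | eq t s => exact h
  | pred R ts => exact hJ _ _ _ h
  | and F G ihF ihG => exact ⟨ihF h.1, ihG h.2⟩
  | or F G ihF ihG => exact h.imp ihF ihG
  | imp F G ihF ihG => exact h.2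
  | all x F ih => exact fun d => ih (h d)
  | ex x F ih => exact h.imp fun d hd => ih hd

theorem update_agree {s : Finset ℕ} {v v' : ℕ → D} {x : ℕ} (h : ∀ z ∈ s.erase x, v z = v' z)
    (d : D) : ∀ z ∈ s, Function.update v x d z = Function.update v' x d z := by
  intro z hz
  by_cases hzx : z = x
  · subst hzx; simp
  · simpa [hzx] using h z (Finset.mem_erase.2 ⟨hzx, hz⟩)

/-- Predicates are read from I and never from S, so the two structures have to agree on function
symbols only. -/
theorem sat_congr {S S' : L.Structure D}
    (hS : ∀ n (f : L.Functions n) ds, S.funMap f ds = S'.funMap f ds) {I I' : RelInterp L D}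
    (F : FOFormula L) (hI : ∀ n R, ⟨n, R⟩ ∈ F.preds → I n R = I' n R) {v v' : ℕ → D}
    (hv : ∀ x ∈ F.freeVars, v x = v' x) : F.Sat S I v ↔ F.Sat S' I' v' := by
  induction F generalizing v v' with
  | bot => exact Iff.rfl
  | eq t s =>
    simp only [Sat]
    rw [realize_congr hS t fun x hx => hv x (Finset.mem_union_left _ hx),
      realize_congr hS s fun x hx => hv x (Finset.mem_union_right _ hx)]
  | pred R ts =>
    simp only [Sat]
    rw [hI _ R rfl]
    have : (fun i => @Language.Term.realize L D S ℕ v (ts i)) =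
        fun i => @Language.Term.realize L D S' ℕ v' (ts i) := funext fun i =>
      realize_congr hS (ts i) fun x hx =>
        hv x (Finset.mem_biUnion.2 ⟨i, Finset.mem_univ _, hx⟩)
    rw [this]
  | and F G ihF ihG =>
    exact and_congr
      (ihF (fun n R h => hI n R (Or.inl h)) fun x hx => hv x (Finset.mem_union_left _ hx))
      (ihG (fun n R h => hI n R (Or.inr h)) fun x hx => hv x (Finset.mem_union_right _ hx))
  | or F G ihF ihG =>
    exact or_congr
      (ihF (fun n R h => hI n R (Or.inl h)) fun x hx => hv x (Finset.mem_union_left _ hx))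
      (ihG (fun n R h => hI n R (Or.inr h)) fun x hx => hv x (Finset.mem_union_right _ hx))
  | imp F G ihF ihG =>
    exact imp_congr
      (ihF (fun n R h => hI n R (Or.inl h)) fun x hx => hv x (Finset.mem_union_left _ hx))
      (ihG (fun n R h => hI n R (Or.inr h)) fun x hx => hv x (Finset.mem_union_right _ hx))
  | all x F ih => exact forall_congr' fun d => ih hI (update_agree hv d)
  | ex x F ih => exact exists_congr fun d => ih hI (update_agree hv d)

theorem hSat_congr {S S' : L.Structure D}
    (hS : ∀ n (f : L.Functions n) ds, S.funMap f ds = S'.funMap f ds) {I I' J J' : RelInterp L D}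
    (F : FOFormula L) (hI : ∀ n R, ⟨n, R⟩ ∈ F.preds → I n R = I' n R)
    (hJ : ∀ n R, ⟨n, R⟩ ∈ F.preds → J n R = J' n R) {v v' : ℕ → D}
    (hv : ∀ x ∈ F.freeVars, v x = v' x) : HSat S I J v F ↔ HSat S' I' J' v' F := by
  induction F generalizing v v' with
  | bot => exact Iff.rfl
  | eq t s => exact sat_congr hS (.eq t s) hI hv
  | pred R ts => exact sat_congr hS (.pred R ts) hJ hv
  | and F G ihF ihG =>
    exact and_congr
      (ihF (fun n R h => hI n R (Or.inl h)) (fun n R h => hJ n R (Or.inl h))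
        fun x hx => hv x (Finset.mem_union_left _ hx))
      (ihG (fun n R h => hI n R (Or.inr h)) (fun n R h => hJ n R (Or.inr h))
        fun x hx => hv x (Finset.mem_union_right _ hx))
  | or F G ihF ihG =>
    exact or_congr
      (ihF (fun n R h => hI n R (Or.inl h)) (fun n R h => hJ n R (Or.inl h))
        fun x hx => hv x (Finset.mem_union_left _ hx))
      (ihG (fun n R h => hI n R (Or.inr h)) (fun n R h => hJ n R (Or.inr h))
        fun x hx => hv x (Finset.mem_union_right _ hx))
  | imp F G ihF ihG =>
    exact and_congr (imp_congr
      (ihF (fun n R h => hI n R (Or.inl h)) (fun n R h => hJ n R (Or.inl h))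
        fun x hx => hv x (Finset.mem_union_left _ hx))
      (ihG (fun n R h => hI n R (Or.inr h)) (fun n R h => hJ n R (Or.inr h))
        fun x hx => hv x (Finset.mem_union_right _ hx))) (sat_congr hS (.imp F G) hI hv)
  | all x F ih => exact forall_congr' fun d => ih hI hJ (update_agree hv d)
  | ex x F ih => exact exists_congr fun d => ih hI hJ (update_agree hv d)

theorem hSat_conj (S : L.Structure D) (I J : RelInterp L D) (l : List (FOFormula L)) (v : ℕ → D) :
    HSat S I J v (conj l) ↔ ∀ F ∈ l, HSat S I J v F := by
  induction l with
  | nil => simp [conj, top, HSat, Sat]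
  | cons F l ih => simpa [conj, HSat] using fun _ => ih

theorem hSat_alls (S : L.Structure D) (I J : RelInterp L D) (xs : List ℕ) (F : FOFormula L)
    (v : ℕ → D) :
    HSat S I J v (alls xs F) ↔ ∀ v' : ℕ → D, (∀ x ∉ xs, v' x = v x) → HSat S I J v' F := by
  induction xs generalizing v with
  | nil =>
    exact ⟨fun h v' hv => (funext fun x => hv x (by simp) : v' = v) ▸ h, fun h => h v (by simp)⟩
  | cons x xs ih =>
    change (∀ d, HSat S I J (Function.update v x d) (alls xs F)) ↔ _
    simp only [ih]
    constructor
    · intro h v' hv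
      refine h (v' x) v' fun z hz => ?_
      by_cases hzx : z = x
      · subst hzx; simp
      · simpa [hzx] using hv z (by simp [hzx, hz])
    · intro h d v' hv
      refine h v' fun z hz => ?_
      simp only [List.mem_cons, not_or] at hz
      simpa [hz.1] using hv z hz.2

theorem hSat_closure (S : L.Structure D) (I J : RelInterp L D) (F : FOFormula L) (v : ℕ → D) :
    HSat S I J v F.closure ↔ ∀ v' : ℕ → D, HSat S I J v' F := by
  classical
  rw [closure, hSat_alls]
  refine ⟨fun h v' => ?_, fun h v' _ => h v'⟩
  -- The closure binds only the free variables, so it is instantiated with v' on those and v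
  -- elsewhere.
  refine (hSat_congr (fun _ _ _ => rfl) F (fun _ _ _ => rfl) (fun _ _ _ => rfl) ?_).1
    (h (fun x => if x ∈ F.freeVars then v' x else v x) fun x hx => ?_)
  · intro x hx; simp [hx]
  · simp only [Finset.mem_toList] at hx; simp [hx]

/-! ### Free variables and symbols of formulas -/

theorem mem_freeVars_conj {l : List (FOFormula L)} {x : ℕ} :
    x ∈ (conj l).freeVars ↔ ∃ F ∈ l, x ∈ F.freeVars := by
  induction l with
  | nil => simp [conj, top, freeVars]
  | cons F l ih => simpa [conj, freeVars] using or_congr_right ih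

theorem mem_freeVars_disj {l : List (FOFormula L)} {x : ℕ} :
    x ∈ (disj l).freeVars ↔ ∃ F ∈ l, x ∈ F.freeVars := by
  induction l with
  | nil => simp [disj, freeVars]
  | cons F l ih => simpa [disj, freeVars] using or_congr_right ih

theorem mem_freeVars_exs {xs : List ℕ} {F : FOFormula L} {x : ℕ} :
    x ∈ (exs xs F).freeVars ↔ x ∈ F.freeVars ∧ x ∉ xs := by
  induction xs with
  | nil => simp [exs]
  | cons z xs ih =>
    change x ∈ (exs xs F).freeVars.erase z ↔ _
    rw [Finset.mem_erase, ih, List.mem_cons]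
    tauto

theorem mem_preds_conj {l : List (FOFormula L)} {q : Σ n, L.Relations n} :
    q ∈ (conj l).preds ↔ ∃ F ∈ l, q ∈ F.preds := by
  induction l with
  | nil => simp [conj, top, preds]
  | cons F l ih => simpa [conj, preds] using or_congr_right ih

theorem mem_funs_conj {l : List (FOFormula L)} {q : Σ n, L.Functions n} :
    q ∈ (conj l).funs ↔ ∃ F ∈ l, q ∈ F.funs := by
  induction l with
  | nil => simp [conj, top, funs]
  | cons F l ih => simpa [conj, funs] using or_congr_right ih

theorem preds_alls (xs : List ℕ) (F : FOFormula L) : (alls xs F).preds = F.preds := by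
  induction xs with
  | nil => rfl
  | cons x xs ih => exact ih

theorem funs_alls (xs : List ℕ) (F : FOFormula L) : (alls xs F).funs = F.funs := by
  induction xs with
  | nil => rfl
  | cons x xs ih => exact ih

end Formula

theorem Atom.freeVars_fol (A : Atom L) : A.fol.freeVars = A.vars := by
  cases A <;> rfl

theorem Atom.mem_vars_rename {A : Atom L} {ρ : ℕ → ℕ} {x : ℕ} (hx : x ∈ (A.rename ρ).vars) :
    ∃ z ∈ A.vars, ρ z = x := by
  cases A with
  | pred R ts =>
    simp only [Atom.rename, Atom.vars, Finset.mem_biUnion] at hx ⊢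
    obtain ⟨i, hi, hx⟩ := hx
    obtain ⟨z, hz, rfl⟩ := mem_varFinset_relabel ρ _ hx
    exact ⟨z, ⟨i, hi, hz⟩, rfl⟩
  | eq t s =>
    simp only [Atom.rename, Atom.vars, Finset.mem_union] at hx ⊢
    rcases hx with hx | hx <;> obtain ⟨z, hz, rfl⟩ := mem_varFinset_relabel ρ _ hx
    exacts [⟨z, Or.inl hz, rfl⟩, ⟨z, Or.inr hz, rfl⟩]

theorem Signed.freeVars_fol {X : Type c} (f : X → FOFormula L) (e : Signed X) :
    (e.fol f).freeVars = (f e.expr).freeVars := by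
  cases e <;> simp [Signed.fol, Signed.expr, Formula.neg, Formula.freeVars]

namespace Aggregate

theorem mem_vars_of_mem_lits {A : Aggregate L} {l : Signed (Atom L)} (hl : l ∈ A.lits) {x : ℕ}
    (hx : x ∈ l.expr.vars) : x ∈ A.vars := by
  refine Finset.mem_union_right _ ?_
  generalize A.lits = ls at hl
  induction ls with
  | nil => simp at hl
  | cons k ls ih =>
    rw [List.foldr_cons, Finset.mem_union]
    rcases List.mem_cons.1 hl with rfl | hl
    exacts [Or.inl hx, Or.inr (ih hl)]

theorem mem_freeVars_inst {A : Aggregate L} {i x : ℕ} (hx : x ∈ (A.inst i).freeVars) :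
    x ∈ A.vars ∨ x ∈ A.newVars i := by
  simp only [inst, Formula.mem_freeVars_conj, List.mem_map] at hx
  obtain ⟨_, ⟨l, hl, rfl⟩, hx⟩ := hx
  rw [Signed.freeVars_fol, Atom.freeVars_fol] at hx
  obtain ⟨z, hz, rfl⟩ := Atom.mem_vars_rename hx
  rw [renamingFn]
  split_ifs with h
  · exact Or.inr (List.mem_map.2 ⟨_, List.mem_range.2 (List.idxOf_lt_length_iff.2 h), rfl⟩)
  · exact Or.inl (mem_vars_of_mem_lits hl hz)

theorem mem_freeVars_eqLists {A : Aggregate L} {i j x : ℕ} (hx : x ∈ (A.eqLists i j).freeVars) :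
    x ∈ A.newVars i ∨ x ∈ A.newVars j := by
  simp only [eqLists, Formula.mem_freeVars_conj, List.mem_map] at hx
  obtain ⟨_, ⟨k, hk, rfl⟩, hx⟩ := hx
  simp only [Formula.freeVars, Language.Term.varFinset, Finset.mem_union,
    Finset.mem_singleton] at hx
  rcases hx with rfl | rfl
  exacts [Or.inl (List.mem_map.2 ⟨k, hk, rfl⟩), Or.inr (List.mem_map.2 ⟨k, hk, rfl⟩)]

/-- Every variable introduced by the renaming is bound by the existential prefix. Freshness plays no
role, and the inclusion suffices for showing that an aggregate avoiding the projected variables is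
insensitive to their values. -/
theorem freeVars_fol_subset (A : Aggregate L) : A.fol.freeVars ⊆ A.vars := by
  intro x hx
  rw [fol, Formula.mem_freeVars_exs] at hx
  obtain ⟨hx, hnew⟩ := hx
  have hnew' : ∀ i < A.bound, x ∉ A.newVars i := fun i hi h =>
    hnew (List.mem_flatMap.2 ⟨i, List.mem_range.2 hi, h⟩)
  rcases Finset.mem_union.1 hx with hx | hx
  · obtain ⟨_, hF, hx⟩ := Formula.mem_freeVars_conj.1 hx
    obtain ⟨i, hi, rfl⟩ := List.mem_map.1 hF
    exact (mem_freeVars_inst hx).resolve_right (hnew' i (List.mem_range.1 hi))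
  · obtain ⟨_, hF, hx⟩ := Formula.mem_freeVars_conj.1 hx
    obtain ⟨j, hj, hF⟩ := List.mem_flatMap.1 hF
    obtain ⟨i, hi, rfl⟩ := List.mem_map.1 hF
    simp only [Formula.neg, Formula.freeVars, Finset.union_empty] at hx
    rw [List.mem_range] at hi hj
    rcases mem_freeVars_eqLists hx with h | h
    exacts [(hnew' i (hi.trans hj) h).elim, (hnew' j hj h).elim]

end Aggregate

/-- The first-order representation of an element of a body. -/
def BodyElem.fol (e : BodyElem L) : FOFormula L := Signed.fol BodyExpr.fol e

theorem BodyElem.freeVars_fol_subset (e : BodyElem L) :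
    (BodyElem.fol e).freeVars ⊆ BodyElem.vars e := by
  rw [BodyElem.fol, Signed.freeVars_fol, BodyElem.vars]
  cases Signed.expr e with
  | atom A => exact (Atom.freeVars_fol A).subset
  | agg A => exact A.freeVars_fol_subset

/-- The additional antecedent that the head contributes to the first-order representation of
a rule. -/
def Head.guard : Head L → FOFormula L
  | .disj _ => Formula.top
  | .choice A => A.fol.neg.neg

/-- The consequent of the first-order representation of a rule. -/
def Head.fol : Head L → FOFormula L
  | .disj as => Formula.disj (as.map Atom.fol)
  | .choice A => A.fol

namespace Head

theorem exists_of_mem_freeVars_fol {H : Head L} {x : ℕ} (hx : x ∈ H.fol.freeVars) :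
    ∃ A ∈ H.atoms, x ∈ A.vars := by
  cases H with
  | disj as =>
    obtain ⟨_, hF, hx⟩ := Formula.mem_freeVars_disj.1 hx
    obtain ⟨A, hA, rfl⟩ := List.mem_map.1 hF
    exact ⟨A, hA, A.freeVars_fol ▸ hx⟩
  | choice A => exact ⟨A, by simp [atoms], A.freeVars_fol ▸ hx⟩

theorem freeVars_guard_subset (H : Head L) : H.guard.freeVars ⊆ H.fol.freeVars := by
  cases H <;> simp [guard, fol, Formula.neg, Formula.top, Formula.freeVars]

theorem preds_guard_subset (H : Head L) : H.guard.preds ⊆ H.fol.preds := by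
  cases H <;> simp [guard, fol, Formula.neg, Formula.top, Formula.preds]

end Head

/-! ### Rules and programs in here-and-there -/

/-- The implication expressed by a rule, evaluated here: for every assignment, the head holds
if the body does. -/
def Rule.Holds (S : L.Structure D) (I J : RelInterp L D) (R : Rule L) : Prop :=
  ∀ v : ℕ → D, Formula.HSat S I J v R.head.guard →
    (∀ e ∈ R.body, Formula.HSat S I J v (BodyElem.fol e)) → Formula.HSat S I J v R.head.fol

theorem hSat_bodyFol (S : L.Structure D) (I J : RelInterp L D) (B : Body L) (v : ℕ → D) :
    Formula.HSat S I J v (bodyFol B) ↔ ∀ e ∈ B, Formula.HSat S I J v (BodyElem.fol e) := by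
  simp [bodyFol, Formula.hSat_conj, BodyElem.fol]

/-- The implication clause demands the rule in both worlds. The guard lets disjunctive and choice
rules share one statement. -/
theorem Rule.hSat_fol (S : L.Structure D) (I J : RelInterp L D) (R : Rule L) (v : ℕ → D) :
    Formula.HSat S I J v R.fol ↔ R.Holds S I J ∧ R.Holds S I I := by
  obtain ⟨H, B⟩ := R
  cases H <;>
    simp [Rule.fol, Formula.hSat_closure, Rule.Holds, Formula.HSat, Head.guard, Head.fol,
      Formula.top, ← Formula.hSat_self, hSat_bodyFol, forall_and, Formula.Sat]

theorem Program.hSat_fol (S : L.Structure D) (I J : RelInterp L D) (Pr : Program L) (v : ℕ → D) :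
    Formula.HSat S I J v Pr.fol ↔ (∀ R ∈ Pr, R.Holds S I J) ∧ ∀ R ∈ Pr, R.Holds S I I := by
  simp [Program.fol, Formula.hSat_conj, Rule.hSat_fol, forall_and]

theorem mem_preds_bodyFol {B : Body L} {q : Σ n, L.Relations n} :
    q ∈ (bodyFol B).preds ↔ ∃ e ∈ B, q ∈ (BodyElem.fol e).preds := by
  simp [bodyFol, Formula.mem_preds_conj, BodyElem.fol]

theorem mem_funs_bodyFol {B : Body L} {q : Σ n, L.Functions n} :
    q ∈ (bodyFol B).funs ↔ ∃ e ∈ B, q ∈ (BodyElem.fol e).funs := by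
  simp [bodyFol, Formula.mem_funs_conj, BodyElem.fol]

theorem Rule.mem_preds_fol {R : Rule L} {q : Σ n, L.Relations n} :
    q ∈ R.fol.preds ↔ q ∈ R.head.fol.preds ∨ ∃ e ∈ R.body, q ∈ (BodyElem.fol e).preds := by
  obtain ⟨H, B⟩ := R
  cases H with
  | disj as =>
    simp only [Rule.fol, Formula.closure, Formula.preds_alls, Formula.preds, Head.fol,
      Set.mem_union, mem_preds_bodyFol]
    exact or_comm
  | choice A =>
    simp [Rule.fol, Formula.closure, Formula.preds_alls, Formula.preds, Head.fol,
      mem_preds_bodyFol, Formula.neg]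
    tauto

theorem Rule.mem_funs_fol {R : Rule L} {q : Σ n, L.Functions n} :
    q ∈ R.fol.funs ↔ q ∈ R.head.fol.funs ∨ ∃ e ∈ R.body, q ∈ (BodyElem.fol e).funs := by
  obtain ⟨H, B⟩ := R
  cases H with
  | disj as =>
    simp only [Rule.fol, Formula.closure, Formula.funs_alls, Formula.funs, Head.fol,
      Set.mem_union, mem_funs_bodyFol]
    exact or_comm
  | choice A =>
    simp [Rule.fol, Formula.closure, Formula.funs_alls, Formula.funs, Head.fol,
      mem_funs_bodyFol, Formula.neg]
    tauto

theorem Program.mem_preds_fol {Pr : Program L} {q : Σ n, L.Relations n} :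
    q ∈ Pr.fol.preds ↔ ∃ R ∈ Pr, q ∈ R.fol.preds := by
  simp [Program.fol, Formula.mem_preds_conj]

theorem Program.mem_funs_fol {Pr : Program L} {q : Σ n, L.Functions n} :
    q ∈ Pr.fol.funs ↔ ∃ R ∈ Pr, q ∈ R.fol.funs := by
  simp [Program.fol, Formula.mem_funs_conj]

theorem Rule.holds_congr {S S' : L.Structure D}
    (hS : ∀ n (f : L.Functions n) ds, S.funMap f ds = S'.funMap f ds) {I I' J J' : RelInterp L D}
    {R : Rule L} (hI : ∀ n P, ⟨n, P⟩ ∈ R.fol.preds → I n P = I' n P)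
    (hJ : ∀ n P, ⟨n, P⟩ ∈ R.fol.preds → J n P = J' n P) :
    R.Holds S I J ↔ R.Holds S' I' J' := by
  have key : ∀ F : FOFormula L, F.preds ⊆ R.fol.preds → ∀ v,
      (F.HSat S I J v ↔ F.HSat S' I' J' v) := fun F hF v =>
    Formula.hSat_congr hS F (fun n P h => hI n P (hF h)) (fun n P h => hJ n P (hF h))
      fun _ _ => rfl
  have hhead : R.head.fol.preds ⊆ R.fol.preds := fun q hq => Rule.mem_preds_fol.2 (Or.inl hq)
  refine forall_congr' fun v => imp_congr (key _ (R.head.preds_guard_subset.trans hhead) v)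
    (imp_congr (forall₂_congr fun e he => key _ (fun q hq => ?_) v) (key _ hhead v))
  exact Rule.mem_preds_fol.2 (Or.inr ⟨e, he, hq⟩)

/-! ### Stable models as minimal here-worlds -/

/-- `I` satisfies the program and is minimal, with respect to the predicate symbols in `p`, among
the here parts of its here-and-there models with there part `I`. -/
def Program.Stable (S : L.Structure D) (p : Finset (Σ n, L.Relations n)) (Pr : Program L)
    (I : RelInterp L D) : Prop :=
  (∀ R ∈ Pr, R.Holds S I I) ∧
    ∀ J : RelInterp L D, (∀ n P ds, J n P ds → I n P ds) →
      (∀ n P, ⟨n, P⟩ ∉ p → J n P = I n P) → (∀ R ∈ Pr, R.Holds S I J) →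
        ∀ n P ds, I n P ds → J n P ds

/-- The interpretation of all predicate symbols; those outside the signature are empty. -/
def Interp.rel {σ : Signature L} [Nonempty D] (M : Interp σ D) : RelInterp L D :=
  fun _ R => M.total.RelMap R

/-- A value U of the predicate variables matters only on p, so it corresponds to the here-world that
is U on p and I elsewhere; U < p says that this world lies strictly below I. -/
theorem Interp.isModelSM_iff_stable {σ : Signature L} [Nonempty D] (M : Interp σ D)
    (p : Finset (Σ n, L.Relations n)) (Pr : Program L) :
    M.IsModelSM p Pr.fol ↔ Pr.Stable M.total p M.rel := by
  classical
  have hFO : ∀ v, M.SatFO v Pr.fol ↔ ∀ R ∈ Pr, R.Holds M.total M.rel M.rel := fun v => by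
    rw [Interp.SatFO, ← Formula.hSat_self]
    exact (Program.hSat_fol M.total M.rel M.rel Pr v).trans and_self_iff
  constructor
  · intro h
    obtain ⟨h₁, h₂⟩ := h fun _ => Classical.arbitrary D
    rw [hFO] at h₁
    refine ⟨h₁, fun J hJ hp hPr n P ds hI => ?_⟩
    by_contra hn
    have hP : ⟨n, P⟩ ∈ p := by
      by_contra hP
      exact hn ((hp n P hP).symm ▸ hI)
    -- A tuple in I but not in J witnesses strictness, since its predicate symbol must belong to p.
    refine h₂ ⟨J, ⟨fun R _ ds => hJ R.1 R.2 ds, fun hge => hn (hge ⟨n, P⟩ hP ds hI)⟩, ?_⟩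
    refine (Formula.sat_star M.total M.rel J p _ _).2 ?_
    have : (fun n R => if (⟨n, R⟩ : Σ n, L.Relations n) ∈ p then J n R else M.rel n R) = J := by
      funext n R
      split_ifs with hR
      exacts [rfl, (hp n R hR).symm]
    rw [this]
    exact (Program.hSat_fol _ _ _ _ _).2 ⟨hPr, h₁⟩
  · rintro ⟨h₁, h₂⟩ v
    refine ⟨(hFO v).2 h₁, ?_⟩
    rintro ⟨U, ⟨hle, hge⟩, hU⟩
    have hU' := (Program.hSat_fol _ _ _ _ _).1 ((Formula.sat_star M.total M.rel U p _ _).1 hU)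
    refine hge fun R hR ds hI => ?_
    have := h₂ _ ?_ ?_ hU'.1 R.1 R.2 ds hI
    · simpa [hR] using this
    · intro n P ds h
      by_cases hP : (⟨n, P⟩ : Σ n, L.Relations n) ∈ p
      · exact hle ⟨n, P⟩ hP ds (by simpa [hP] using h)
      · simpa [hP] using h
    · intro n P hP
      simp [hP]

/-! ### Reinterpreting u, and the projection of α -/

/-- The interpretation that agrees with `I` except that `u` is interpreted by `X`. -/
def RelInterp.set (I : RelInterp L D) {n : ℕ} (u : L.Relations n) (X : (Fin n → D) → Prop) :
    RelInterp L D := fun m P ds =>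
  ((⟨m, P⟩ : Σ n, L.Relations n) ≠ ⟨n, u⟩ ∧ I m P ds) ∨
    -- Equality of dependent triples avoids transporting ds along an equality of arities.
    ∃ ds' : Fin n → D, X ds' ∧
      (⟨m, P, ds⟩ : Σ m, L.Relations m × (Fin m → D)) = ⟨n, u, ds'⟩

namespace RelInterp

variable (I : RelInterp L D) {n : ℕ} (u : L.Relations n) (X : (Fin n → D) → Prop)

@[simp]
theorem set_self : I.set u X n u = X := by
  funext ds
  simp [set]

theorem set_of_ne {m : ℕ} {P : L.Relations m} (h : (⟨m, P⟩ : Σ n, L.Relations n) ≠ ⟨n, u⟩) :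
    I.set u X m P = I m P := by
  funext ds
  simp only [set, ne_eq, h, not_false_eq_true, true_and, eq_iff_iff, or_iff_left_iff_imp]
  rintro ⟨ds', -, hd⟩
  cases hd
  exact (h rfl).elim

end RelInterp

/-- The tuples that `y` takes in assignments satisfying all members of `α`. -/
def projection (S : L.Structure D) (I J : RelInterp L D) (α : Body L) {n : ℕ} (y : Fin n → ℕ)
    (ds : Fin n → D) : Prop :=
  ∃ v : ℕ → D, (∀ i, v (y i) = ds i) ∧ ∀ e ∈ α, Formula.HSat S I J v (BodyElem.fol e)

theorem projection_congr {S S' : L.Structure D}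
    (hS : ∀ n (f : L.Functions n) ds, S.funMap f ds = S'.funMap f ds) {I I' J J' : RelInterp L D}
    {α : Body L} {n : ℕ} {y : Fin n → ℕ}
    (hI : ∀ e ∈ α, ∀ n P, ⟨n, P⟩ ∈ (BodyElem.fol e).preds → I n P = I' n P)
    (hJ : ∀ e ∈ α, ∀ n P, ⟨n, P⟩ ∈ (BodyElem.fol e).preds → J n P = J' n P) :
    projection S I J α y = projection S' I' J' α y := by
  funext ds
  refine propext (exists_congr fun v => and_congr_right fun _ => forall₂_congr fun e he => ?_)
  exact Formula.hSat_congr hS _ (hI e he) (hJ e he) fun _ _ => rfl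

theorem projection_mono {S : L.Structure D} {I J : RelInterp L D}
    (hJ : ∀ n P ds, J n P ds → I n P ds) {α : Body L} {n : ℕ} {y : Fin n → ℕ} {ds : Fin n → D}
    (h : projection S I J α y ds) : projection S I I α y ds := by
  obtain ⟨v, hv, hα⟩ := h
  exact ⟨v, hv, fun e he => (Formula.hSat_self S I _ v).2 ((hα e he).sat hJ)⟩

theorem hSat_varAtom (S : L.Structure D) (I J : RelInterp L D) {n : ℕ} (u : L.Relations n)
    (y : Fin n → ℕ) (v : ℕ → D) :
    Formula.HSat S I J v (varAtom u y).fol ↔ J n u fun i => v (y i) := by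
  simp [varAtom, Atom.fol, Formula.HSat]

/-- The head depends only on y, so universal quantification over the other variables turns into an
existential in the body. -/
theorem holds_projectionRule (S : L.Structure D) (I J : RelInterp L D) (α : Body L) {n : ℕ}
    (u : L.Relations n) (y : Fin n → ℕ) :
    Rule.Holds S I J ⟨.disj [varAtom u y], α⟩ ↔ ∀ ds, projection S I J α y ds → J n u ds := by
  have hhead : ∀ v, Formula.HSat S I J v (Head.disj [varAtom u y]).fol ↔
      J n u fun i => v (y i) := fun v => by
    simp [Head.fol, Formula.disj, Formula.HSat, hSat_varAtom]
  constructor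
  · rintro h ds ⟨v, hv, hα⟩
    have := (hhead v).1 (h v (by simp [Head.guard, Formula.top, Formula.HSat]) hα)
    simpa only [hv] using this
  · exact fun h v _ hα => (hhead v).2 (h _ ⟨v, fun _ => rfl, hα⟩)

open Classical in
/-- The rule `H ← (B ∖ α) ∪ α' ∪ {u(y)}`. -/
noncomputable def projectedRule (R : Rule L) (α α' : Body L) {n : ℕ} (u : L.Relations n)
    (y : Fin n → ℕ) : Rule L :=
  ⟨R.head, (R.body \ α) ∪ α' ∪ {.pos (.atom (varAtom u y))}⟩

theorem forall_mem_projectedRule_body {R : Rule L} {α α' : Body L} {n : ℕ} {u : L.Relations n}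
    {y : Fin n → ℕ} {C : BodyElem L → Prop} :
    (∀ e ∈ (projectedRule R α α' u y).body, C e) ↔
      (∀ e ∈ R.body, e ∉ α → C e) ∧ (∀ e ∈ α', C e) ∧ C (.pos (.atom (varAtom u y))) := by
  simp only [projectedRule, Finset.mem_union, Finset.mem_sdiff, Finset.mem_singleton]
  constructor
  · exact fun h => ⟨fun e h₁ h₂ => h e (Or.inl (Or.inl ⟨h₁, h₂⟩)),
      fun e he => h e (Or.inl (Or.inr he)), h _ (Or.inr rfl)⟩
  · rintro ⟨h₁, h₂, h₃⟩ e ((he | he) | rfl)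
    exacts [h₁ e he.1 he.2, h₂ e he, h₃]

/-- If the projection is contained in `u`, then the projected rule entails the original one. -/
theorem holds_of_projectedRule {S : L.Structure D} {I J : RelInterp L D} {R : Rule L}
    {α α' : Body L} {n : ℕ} {u : L.Relations n} {y : Fin n → ℕ} (hα : α ⊆ R.body) (hα' : α' ⊆ α)
    (hQ : ∀ ds, projection S I J α y ds → J n u ds)
    (h : (projectedRule R α α' u y).Holds S I J) : R.Holds S I J := by
  intro v hg hB
  refine h v hg (forall_mem_projectedRule_body.2
    ⟨fun e he _ => hB e he, fun e he => hB e (hα (hα' he)), ?_⟩)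
  exact (hSat_varAtom S I J u y v).2 (hQ _ ⟨v, fun _ => rfl, fun e he => hB e (hα he)⟩)

/-- If `u` is contained in the projection, then the original rule entails the projected one. -/
theorem holds_projectedRule {S : L.Structure D} {I J : RelInterp L D} {R : Rule L} {xs : List ℕ}
    (hocc : OnlyInBodyLiterals R xs)
    {α α' : Body L} {n : ℕ} {u : L.Relations n} {y : Fin n → ℕ}
    (hxα : ∀ e ∈ R.body, BodyElem.IsLiteral e → (∃ x ∈ xs, x ∈ BodyElem.vars e) → e ∈ α)
    (hy : ∀ z, z ∈ Set.range y ↔ (∃ e ∈ α, z ∈ BodyElem.vars e) ∧ z ∉ xs)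
    (hQ : ∀ ds, J n u ds → projection S I J α y ds)
    (h : R.Holds S I J) : (projectedRule R α α' u y).Holds S I J := by
  classical
  intro v hg hB
  obtain ⟨hB, -, hu⟩ := forall_mem_projectedRule_body.1 hB
  obtain ⟨v', hv', hv'α⟩ := hQ _ ((hSat_varAtom S I J u y v).1 hu)
  -- Values witnessing α on the projected variables are grafted onto v; R is then applied under this
  -- mixed assignment, and its head is read back under v.
  let v'' : ℕ → D := fun x => if x ∈ xs then v' x else v x
  have hoff : ∀ F : FOFormula L, (∀ x ∈ F.freeVars, x ∉ xs) →
      (Formula.HSat S I J v'' F ↔ Formula.HSat S I J v F) := fun F hF =>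
    Formula.hSat_congr (fun _ _ _ => rfl) F (fun _ _ _ => rfl) (fun _ _ _ => rfl)
      fun x hx => if_neg (hF x hx)
  have hhead : ∀ x ∈ R.head.fol.freeVars, x ∉ xs := fun x hx hxs => by
    obtain ⟨A, hA, hxA⟩ := Head.exists_of_mem_freeVars_fol hx
    exact hocc.not_in_head x hxs A hA hxA
  refine (hoff _ hhead).1 (h v''
    ((hoff _ fun x hx => hhead x (R.head.freeVars_guard_subset hx)).2 hg) fun e he => ?_)
  by_cases heα : e ∈ α
  · refine (Formula.hSat_congr (fun _ _ _ => rfl) _ (fun _ _ _ => rfl) (fun _ _ _ => rfl)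
      fun x hx => ?_).1 (hv'α e heα)
    -- A variable of α outside xs is some y i, where v' and v agree by the choice of v'.
    by_cases hxs : x ∈ xs
    · exact (if_pos hxs).symm
    · obtain ⟨i, rfl⟩ := (hy x).2 ⟨⟨e, heα, BodyElem.freeVars_fol_subset e hx⟩, hxs⟩
      exact (hv' i).trans (if_neg hxs).symm
  · refine (hoff _ fun x hx hxs => ?_).2 (hB e he heα)
    have hxe := BodyElem.freeVars_fol_subset e hx
    -- Outside α no projected variable occurs: a literal with one would be in α, and aggregates are
    -- excluded by hypothesis.
    by_cases hlit : BodyElem.IsLiteral e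
    · exact heα (hxα e he hlit ⟨x, hxs, hxe⟩)
    · exact hocc.not_in_aggregates x hxs e he hlit hxe

theorem Program.forall_mem_replace {Pr : Program L} {R R₁ R₂ : Rule L} {C : Rule L → Prop} :
    (∀ T ∈ Pr.replace R R₁ R₂, C T) ↔ (∀ T ∈ Pr, T ≠ R → C T) ∧ C R₁ ∧ C R₂ := by
  simp only [Program.replace, Finset.mem_union, Finset.mem_sdiff, Finset.mem_singleton,
    Finset.mem_insert]
  constructor
  · exact fun h => ⟨fun T h₁ h₂ => h T (Or.inl ⟨h₁, h₂⟩), h _ (Or.inr (Or.inl rfl)),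
      h _ (Or.inr (Or.inr rfl))⟩
  · rintro ⟨h₁, h₂, h₃⟩ T (hT | rfl | rfl)
    exacts [h₁ T hT.1 hT.2, h₂, h₃]

theorem Program.exists_mem_replace {Pr : Program L} {R R₁ R₂ : Rule L} {C : Rule L → Prop} :
    (∃ T ∈ Pr.replace R R₁ R₂, C T) ↔ (∃ T ∈ Pr, T ≠ R ∧ C T) ∨ C R₁ ∨ C R₂ := by
  have := Program.forall_mem_replace (Pr := Pr) (R := R) (R₁ := R₁) (R₂ := R₂)
    (C := fun T => ¬ C T)
  rw [← not_iff_not]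
  push Not
  exact this

/-! ### Transfer of stability between the two programs -/

section Projecting

variable {Pr : Program L} {R : Rule L} {xs : List ℕ} {n : ℕ} {u : L.Relations n}
  {α α' : Body L} {y : Fin n → ℕ} {S : L.Structure D} {p : Finset (Σ n, L.Relations n)}

/-- Rules of `Pr` do not contain `u`, so that changing `u` does not affect them. -/
theorem eq_on_preds_of_ne (hu : ⟨n, u⟩ ∉ Pr.fol.preds) {I I' : RelInterp L D}
    (hI : ∀ m P, (⟨m, P⟩ : Σ n, L.Relations n) ≠ ⟨n, u⟩ → I m P = I' m P) {T : Rule L}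
    (hT : T ∈ Pr) (m : ℕ) (P : L.Relations m) (hP : ⟨m, P⟩ ∈ T.fol.preds) : I m P = I' m P :=
  hI m P fun h => hu (Program.mem_preds_fol.2 ⟨T, hT, h ▸ hP⟩)

theorem holds_congr_of_ne (hu : ⟨n, u⟩ ∉ Pr.fol.preds) {I I' J J' : RelInterp L D}
    (hI : ∀ m P, (⟨m, P⟩ : Σ n, L.Relations n) ≠ ⟨n, u⟩ → I m P = I' m P)
    (hJ : ∀ m P, (⟨m, P⟩ : Σ n, L.Relations n) ≠ ⟨n, u⟩ → J m P = J' m P) {T : Rule L}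
    (hT : T ∈ Pr) : T.Holds S I J ↔ T.Holds S I' J' :=
  Rule.holds_congr (fun _ _ _ => rfl) (eq_on_preds_of_ne hu hI hT) (eq_on_preds_of_ne hu hJ hT)

theorem projection_congr_of_ne (hu : ⟨n, u⟩ ∉ Pr.fol.preds) (hR : R ∈ Pr) (hα : α ⊆ R.body)
    {I I' J J' : RelInterp L D}
    (hI : ∀ m P, (⟨m, P⟩ : Σ n, L.Relations n) ≠ ⟨n, u⟩ → I m P = I' m P)
    (hJ : ∀ m P, (⟨m, P⟩ : Σ n, L.Relations n) ≠ ⟨n, u⟩ → J m P = J' m P) :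
    projection S I J α y = projection S I' J' α y :=
  projection_congr (fun _ _ _ => rfl)
    (fun e he m P hP => eq_on_preds_of_ne hu hI hR m P
      (Rule.mem_preds_fol.2 (Or.inr ⟨e, hα he, hP⟩)))
    (fun e he m P hP => eq_on_preds_of_ne hu hJ hR m P
      (Rule.mem_preds_fol.2 (Or.inr ⟨e, hα he, hP⟩)))

/-- The result of replacing `R` in `Pr`. -/
noncomputable abbrev projectedProgram (Pr : Program L) (R : Rule L) (α α' : Body L) {n : ℕ}
    (u : L.Relations n) (y : Fin n → ℕ) : Program L :=
  Pr.replace R (projectedRule R α α' u y) ⟨.disj [varAtom u y], α⟩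

/-- The defining rule for u supplies exactly the inclusion needed to recover R, so nothing has to be
assumed about u. -/
theorem forall_holds_of_projectedProgram (hα : α ⊆ R.body) (hα' : α' ⊆ α) {I J : RelInterp L D}
    (h : ∀ T ∈ projectedProgram Pr R α α' u y, T.Holds S I J) : ∀ T ∈ Pr, T.Holds S I J := by
  obtain ⟨h, h₁, h₂⟩ := Program.forall_mem_replace.1 h
  intro T hT
  by_cases hTR : T = R
  · subst hTR
    exact holds_of_projectedRule hα hα' ((holds_projectionRule S I J α u y).1 h₂) h₁
  · exact h T hT hTR

/-- Both inclusions in `hQ` are used: one for the projected rule, the other for the defining rule of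
u. -/
theorem forall_holds_projectedProgram (hR : R ∈ Pr) (hocc : OnlyInBodyLiterals R xs)
    (hxα : ∀ e ∈ R.body, BodyElem.IsLiteral e → (∃ x ∈ xs, x ∈ BodyElem.vars e) → e ∈ α)
    (hy : ∀ z, z ∈ Set.range y ↔ (∃ e ∈ α, z ∈ BodyElem.vars e) ∧ z ∉ xs)
    {I J : RelInterp L D} (hQ : J n u = projection S I J α y)
    (h : ∀ T ∈ Pr, T.Holds S I J) : ∀ T ∈ projectedProgram Pr R α α' u y, T.Holds S I J := by
  refine Program.forall_mem_replace.2 ⟨fun T hT _ => h T hT, ?_, ?_⟩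
  · exact holds_projectedRule hocc hxα hy (fun ds hd => hQ ▸ hd) (h R hR)
  · exact (holds_projectionRule S I J α u y).2 fun ds hd => hQ ▸ hd

/-- In a stable model of the projected program, `u` is interpreted by the projection. -/
theorem Program.Stable.eq_projection (hu : ⟨n, u⟩ ∉ Pr.fol.preds) (hR : R ∈ Pr)
    (hocc : OnlyInBodyLiterals R xs) (hα : α ⊆ R.body) (hα' : α' ⊆ α)
    (hxα : ∀ e ∈ R.body, BodyElem.IsLiteral e → (∃ x ∈ xs, x ∈ BodyElem.vars e) → e ∈ α)
    (hy : ∀ z, z ∈ Set.range y ↔ (∃ e ∈ α, z ∈ BodyElem.vars e) ∧ z ∉ xs)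
    {I : RelInterp L D}
    (h : (projectedProgram Pr R α α' u y).Stable S (extendPreds p u) I) :
    I n u = projection S I I α y := by
  have hle := (holds_projectionRule S I I α u y).1 (Program.forall_mem_replace.1 h.1).2.2
  have hset := fun m (P : L.Relations m) hP => I.set_of_ne u (projection S I I α y) (P := P) hP
  refine funext fun ds => propext ⟨fun hI => ?_, hle ds⟩
  -- Minimality is tested against the here-world in which u is cut down to the projection and all
  -- else is kept.
  have := h.2 (I.set u (projection S I I α y)) ?_ ?_ ?_ n u ds hI
  · simpa using this
  · intro m P ds hP
    by_cases hPu : (⟨m, P⟩ : Σ n, L.Relations n) = ⟨n, u⟩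
    · cases hPu
      exact hle _ (by simpa using hP)
    · rwa [hset m P hPu] at hP
  · intro m P hP
    exact hset m P fun h => hP (by simp [extendPreds, h])
  · refine forall_holds_projectedProgram hR hocc hxα hy ?_ fun T hT =>
      (holds_congr_of_ne hu (fun _ _ _ => rfl) hset hT).2
        (forall_holds_of_projectedProgram hα hα' h.1 T hT)
    rw [RelInterp.set_self]
    exact projection_congr_of_ne hu hR hα (fun _ _ _ => rfl) fun m P hP => (hset m P hP).symm

/-- A here-world J for `Pr` is expanded by its own projection to one for the projected program;
minimality there gives I ≤ J off u. At u itself J equals I, because u is not in p. -/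
theorem Program.Stable.of_projectedProgram (hu : ⟨n, u⟩ ∉ Pr.fol.preds) (hR : R ∈ Pr)
    (hp : ⟨n, u⟩ ∉ p)
    (hocc : OnlyInBodyLiterals R xs) (hα : α ⊆ R.body) (hα' : α' ⊆ α)
    (hxα : ∀ e ∈ R.body, BodyElem.IsLiteral e → (∃ x ∈ xs, x ∈ BodyElem.vars e) → e ∈ α)
    (hy : ∀ z, z ∈ Set.range y ↔ (∃ e ∈ α, z ∈ BodyElem.vars e) ∧ z ∉ xs)
    {I I' : RelInterp L D}
    (hI : ∀ m P, (⟨m, P⟩ : Σ n, L.Relations n) ≠ ⟨n, u⟩ → I' m P = I m P)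
    (h : (projectedProgram Pr R α α' u y).Stable S (extendPreds p u) I') :
    Pr.Stable S p I := by
  have hI'u := h.eq_projection hu hR hocc hα hα' hxα hy
  refine ⟨fun T hT => (holds_congr_of_ne hu hI hI hT).1
    (forall_holds_of_projectedProgram hα hα' h.1 T hT), fun J hJI hJp hJ m P ds hP => ?_⟩
  by_cases hPu : (⟨m, P⟩ : Σ n, L.Relations n) = ⟨n, u⟩
  · rwa [hJp m P (hPu ▸ hp)]
  let Q := projection S I' J α y
  have hset := fun m (P : L.Relations m) hP => J.set_of_ne u Q (P := P) hP
  have hle : ∀ m P ds, J.set u Q m P ds → I' m P ds := by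
    have hQ : Q = projection S I' (J.set u Q) α y :=
      projection_congr_of_ne hu hR hα (fun _ _ _ => rfl) fun m P hP => (hset m P hP).symm
    intro m P ds hP
    by_cases hPu : (⟨m, P⟩ : Σ n, L.Relations n) = ⟨n, u⟩
    · cases hPu
      rw [RelInterp.set_self] at hP
      -- Here I' interprets u by its own projection, so the bound reduces to monotonicity of the
      -- projection from J to I.
      rw [hI'u, projection_congr_of_ne hu hR hα hI hI]
      refine projection_mono hJI (?_ : projection S I J α y ds)
      rwa [← projection_congr_of_ne hu hR hα hI fun _ _ _ => rfl]
    · rw [hset m P hPu] at hP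
      exact hI m P hPu ▸ hJI m P ds hP
  rw [← hset m P hPu]
  refine h.2 _ hle ?_ ?_ m P ds (hI m P hPu ▸ hP)
  · intro m P hP
    simp only [extendPreds, Finset.mem_insert, not_or] at hP
    rw [hset m P hP.1, hI m P hP.1, hJp m P hP.2]
  · refine forall_holds_projectedProgram hR hocc hxα hy ?_ fun T hT =>
      (holds_congr_of_ne hu hI hset hT).2 (hJ T hT)
    rw [RelInterp.set_self]
    exact projection_congr_of_ne hu hR hα (fun _ _ _ => rfl) fun m P hP => (hset m P hP).symm

/-- A here-world J of the projected program satisfies `Pr`, so minimality makes it agree with I' off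
u. The defining rule then forces its u to contain the projection, which is the value of u in I'. -/
theorem Program.Stable.projectedProgram (hu : ⟨n, u⟩ ∉ Pr.fol.preds) (hR : R ∈ Pr)
    (hocc : OnlyInBodyLiterals R xs) (hα : α ⊆ R.body) (hα' : α' ⊆ α)
    (hxα : ∀ e ∈ R.body, BodyElem.IsLiteral e → (∃ x ∈ xs, x ∈ BodyElem.vars e) → e ∈ α)
    (hy : ∀ z, z ∈ Set.range y ↔ (∃ e ∈ α, z ∈ BodyElem.vars e) ∧ z ∉ xs)
    {I I' : RelInterp L D}
    (hI : ∀ m P, (⟨m, P⟩ : Σ n, L.Relations n) ≠ ⟨n, u⟩ → I' m P = I m P)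
    (hI'u : I' n u = projection S I' I' α y) (h : Pr.Stable S p I) :
    (RASPL.projectedProgram Pr R α α' u y).Stable S (extendPreds p u) I' := by
  refine ⟨forall_holds_projectedProgram hR hocc hxα hy hI'u fun T hT =>
    (holds_congr_of_ne hu hI hI hT).2 (h.1 T hT), fun J hJI hJp hJ => ?_⟩
  -- Stability of I only concerns worlds that agree with I off p, so u is reset to its value in I.
  have hset := fun m (P : L.Relations m) hP => J.set_of_ne u (I n u) (P := P) hP
  have hIJ : ∀ m P, (⟨m, P⟩ : Σ n, L.Relations n) ≠ ⟨n, u⟩ → ∀ ds, I' m P ds → J m P ds := by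
    intro m P hPu ds hP
    rw [← hset m P hPu]
    refine h.2 _ ?_ ?_ ?_ m P ds (hI m P hPu ▸ hP)
    · intro m P ds hP
      by_cases hPu : (⟨m, P⟩ : Σ n, L.Relations n) = ⟨n, u⟩
      · cases hPu
        simpa using hP
      · rw [hset m P hPu] at hP
        exact hI m P hPu ▸ hJI m P ds hP
    · intro m P hP
      by_cases hPu : (⟨m, P⟩ : Σ n, L.Relations n) = ⟨n, u⟩
      · cases hPu
        simp
      · rw [hset m P hPu, ← hI m P hPu, hJp m P (by simp [extendPreds, hPu, hP])]
    · exact fun T hT => (holds_congr_of_ne hu hI (fun m P hP => (hset m P hP).symm) hT).1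
        (forall_holds_of_projectedProgram hα hα' hJ T hT)
  intro m P ds hP
  by_cases hPu : (⟨m, P⟩ : Σ n, L.Relations n) = ⟨n, u⟩
  · cases hPu
    refine (holds_projectionRule S I' J α u y).1 (Program.forall_mem_replace.1 hJ).2.2 ds ?_
    rw [hI'u] at hP
    -- J and I' now agree off u, hence yield the same projection.
    rwa [← projection_congr_of_ne hu hR hα (I := I') (fun _ _ _ => rfl) fun m P hPu =>
      funext fun ds => propext ⟨hIJ m P hPu ds, hJI m P ds⟩]
  · exact hIJ m P hPu ds hP

/-! ### Signature of the projected program -/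

/-- No symbol of R is lost, because α survives as the body of the rule defining u. -/
theorem preds_fol_projectedProgram (hR : R ∈ Pr) (hα : α ⊆ R.body) (hα' : α' ⊆ α) :
    (projectedProgram Pr R α α' u y).fol.preds = insert ⟨n, u⟩ Pr.fol.preds := by
  have hat : ∀ q : Σ n, L.Relations n, q ∈ (varAtom u y).fol.preds ↔ q = ⟨n, u⟩ := fun q => Iff.rfl
  ext q
  rw [Program.mem_preds_fol, Program.exists_mem_replace, Set.mem_insert_iff,
    Program.mem_preds_fol]
  simp only [Rule.mem_preds_fol (R := projectedRule R α α' u y),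
    Rule.mem_preds_fol (R := ⟨.disj [varAtom u y], α⟩)]
  constructor
  · rintro (⟨T, hT, -, hq⟩ | (hq | ⟨e, he, hq⟩) | (hq | ⟨e, he, hq⟩))
    · exact Or.inr ⟨T, hT, hq⟩
    · exact Or.inr ⟨R, hR, Rule.mem_preds_fol.2 (Or.inl hq)⟩
    · simp only [projectedRule, Finset.mem_union, Finset.mem_sdiff, Finset.mem_singleton] at he
      rcases he with (he | he) | rfl
      · exact Or.inr ⟨R, hR, Rule.mem_preds_fol.2 (Or.inr ⟨e, he.1, hq⟩)⟩
      · exact Or.inr ⟨R, hR, Rule.mem_preds_fol.2 (Or.inr ⟨e, hα (hα' he), hq⟩)⟩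
      · exact Or.inl hq
    · exact Or.inl (by simpa [Head.fol, Formula.disj, Formula.preds, hat] using hq)
    · exact Or.inr ⟨R, hR, Rule.mem_preds_fol.2 (Or.inr ⟨e, hα he, hq⟩)⟩
  · rintro (rfl | ⟨T, hT, hq⟩)
    · exact Or.inr (Or.inr (Or.inl (by simp [Head.fol, Formula.disj, Formula.preds, hat])))
    · by_cases hTR : T = R
      · subst hTR
        rcases Rule.mem_preds_fol.1 hq with hq | ⟨e, he, hq⟩
        · exact Or.inr (Or.inl (Or.inl hq))
        · by_cases heα : e ∈ α
          · exact Or.inr (Or.inr (Or.inr ⟨e, heα, hq⟩))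
          · exact Or.inr (Or.inl (Or.inr ⟨e, by simp [projectedRule, he, heα], hq⟩))
      · exact Or.inl ⟨T, hT, hTR, hq⟩

theorem funs_fol_projectedProgram (hR : R ∈ Pr) (hα : α ⊆ R.body) (hα' : α' ⊆ α) :
    (projectedProgram Pr R α α' u y).fol.funs = Pr.fol.funs := by
  have hat : (varAtom u y).fol.funs = ∅ := by
    simp [varAtom, Atom.fol, Formula.funs, termFuns]
  ext q
  rw [Program.mem_funs_fol, Program.exists_mem_replace, Program.mem_funs_fol]
  simp only [Rule.mem_funs_fol (R := projectedRule R α α' u y),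
    Rule.mem_funs_fol (R := ⟨.disj [varAtom u y], α⟩)]
  constructor
  · rintro (⟨T, hT, -, hq⟩ | (hq | ⟨e, he, hq⟩) | (hq | ⟨e, he, hq⟩))
    · exact ⟨T, hT, hq⟩
    · exact ⟨R, hR, Rule.mem_funs_fol.2 (Or.inl hq)⟩
    · simp only [projectedRule, Finset.mem_union, Finset.mem_sdiff, Finset.mem_singleton] at he
      rcases he with (he | he) | rfl
      · exact ⟨R, hR, Rule.mem_funs_fol.2 (Or.inr ⟨e, he.1, hq⟩)⟩
      · exact ⟨R, hR, Rule.mem_funs_fol.2 (Or.inr ⟨e, hα (hα' he), hq⟩)⟩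
      · exact (Set.eq_empty_iff_forall_notMem.1 hat q hq).elim
    · simp [Head.fol, Formula.disj, Formula.funs, hat] at hq
    · exact ⟨R, hR, Rule.mem_funs_fol.2 (Or.inr ⟨e, hα he, hq⟩)⟩
  · rintro ⟨T, hT, hq⟩
    by_cases hTR : T = R
    · subst hTR
      rcases Rule.mem_funs_fol.1 hq with hq | ⟨e, he, hq⟩
      · exact Or.inr (Or.inl (Or.inl hq))
      · by_cases heα : e ∈ α
        · exact Or.inr (Or.inr (Or.inr ⟨e, heα, hq⟩))
        · exact Or.inr (Or.inl (Or.inr ⟨e, by simp [projectedRule, he, heα], hq⟩))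
    · exact Or.inl ⟨T, hT, hTR, hq⟩

end Projecting

theorem Program.stable_congr_structure {S S' : L.Structure D}
    (hS : ∀ n (f : L.Functions n) ds, S.funMap f ds = S'.funMap f ds) {Pr : Program L}
    {p : Finset (Σ n, L.Relations n)} {I : RelInterp L D} (h : Pr.Stable S p I) :
    Pr.Stable S' p I := by
  have hT : ∀ J, ∀ T : Rule L, T.Holds S I J ↔ T.Holds S' I J := fun J T =>
    Rule.holds_congr hS (fun _ _ _ => rfl) fun _ _ _ => rfl
  exact ⟨fun T hTP => (hT I T).1 (h.1 T hTP), fun J hJ hp hPr =>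
    h.2 J hJ hp fun T hTP => (hT J T).2 (hPr T hTP)⟩

/-! ### Restriction of interpretations -/

namespace Interp

variable {σ τ : Signature L}

theorem ext_of_eq {M N : Interp σ D}
    (hfn : ∀ n (f : L.Functions n) (h : ⟨n, f⟩ ∈ σ.funs), M.fn f h = N.fn f h)
    (hpr : ∀ n (P : L.Relations n) (h : ⟨n, P⟩ ∈ σ.preds), M.pr P h = N.pr P h) : M = N := by
  obtain ⟨f, r⟩ := M
  obtain ⟨f', r'⟩ := N
  congr
  · funext n g h; exact hfn n g h
  · funext n P h; exact hpr n P h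

variable [Nonempty D]

theorem rel_eq_pr {M : Interp σ D} {n : ℕ} {P : L.Relations n} (h : ⟨n, P⟩ ∈ σ.preds) :
    M.rel n P = M.pr P h := by
  funext ds
  exact propext ⟨fun ⟨_, h⟩ => h, fun h' => ⟨h, h'⟩⟩

theorem rel_of_notMem {M : Interp σ D} {n : ℕ} {P : L.Relations n} (h : ⟨n, P⟩ ∉ σ.preds) :
    M.rel n P = fun _ => False := by
  funext ds
  exact propext ⟨fun ⟨h', _⟩ => h h', False.elim⟩

theorem total_funMap_of_mem (M : Interp σ D) {n : ℕ} {f : L.Functions n} (h : ⟨n, f⟩ ∈ σ.funs)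
    (ds : Fin n → D) : M.total.funMap f ds = M.fn f h ds :=
  dif_pos h

theorem total_funMap_of_notMem (M : Interp σ D) {n : ℕ} {f : L.Functions n}
    (h : ⟨n, f⟩ ∉ σ.funs) (ds : Fin n → D) : M.total.funMap f ds = Classical.arbitrary D :=
  dif_neg h

/-- With equal sets of function symbols, the default value `Classical.arbitrary D` is used for the
same symbols on both sides. -/
theorem total_funMap_restrict (h : σ.Sub τ) (hfuns : τ.funs = σ.funs) (M : Interp τ D) (n : ℕ)
    (f : L.Functions n) (ds : Fin n → D) :
    M.total.funMap f ds = (M.restrict h).total.funMap f ds := by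
  by_cases hf : ⟨n, f⟩ ∈ σ.funs
  · have hf' := h.1 hf
    exact (total_funMap_of_mem M hf' ds).trans (total_funMap_of_mem (M.restrict h) hf ds).symm
  · have hf' : ⟨n, f⟩ ∉ τ.funs := hfuns ▸ hf
    exact (total_funMap_of_notMem M hf' ds).trans
      (total_funMap_of_notMem (M.restrict h) hf ds).symm

/-- Symbols outside a signature are read as empty, and u is the only symbol that the larger
signature may add. -/
theorem rel_restrict (h : σ.Sub τ) {n : ℕ} {u : L.Relations n}
    (hpreds : τ.preds = insert ⟨n, u⟩ σ.preds) (M : Interp τ D) (m : ℕ) (P : L.Relations m)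
    (hP : (⟨m, P⟩ : Σ n, L.Relations n) ≠ ⟨n, u⟩) : M.rel m P = (M.restrict h).rel m P := by
  by_cases hσ : ⟨m, P⟩ ∈ σ.preds
  · rw [rel_eq_pr hσ, rel_eq_pr (h.2 hσ)]
    rfl
  · rw [rel_of_notMem hσ, rel_of_notMem (by rw [hpreds]; simp [hP, hσ])]

end Interp

end RASPL

/-! ### The correspondence of models -/

theorem mainTheorem3 {L : FirstOrder.Language.{a, b}}
    (Pr : RASPL.Program L) (R : RASPL.Rule L) (hR : R ∈ Pr)
    (xs : List ℕ) (hxs : xs ≠ []) (hocc : RASPL.OnlyInBodyLiterals R xs)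
    {n : ℕ} (u : L.Relations n)
    (hu : ⟨n, u⟩ ∉ (RASPL.Program.fol Pr).sig.preds)
    (R₁ R₂ : RASPL.Rule L) (hproj : RASPL.IsProjection R xs u R₁ R₂)
    (p : Finset (Σ n, L.Relations n))
    (hp : ∀ q ∈ p, q ∈ (RASPL.Program.fol Pr).sig.preds)
    (D : Type w) [Nonempty D] :
    ∃ h : (RASPL.Program.fol Pr).sig.Sub
        (RASPL.Program.fol (RASPL.Program.replace Pr R R₁ R₂)).sig,
      Set.BijOn (RASPL.Interp.restrict h)
        {M : RASPL.Interp (RASPL.Program.fol (RASPL.Program.replace Pr R R₁ R₂)).sig D |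
          M.IsModelSM (RASPL.extendPreds p u)
            (RASPL.Program.fol (RASPL.Program.replace Pr R R₁ R₂))}
        {M : RASPL.Interp (RASPL.Program.fol Pr).sig D |
          M.IsModelSM p (RASPL.Program.fol Pr)} := by
  open RASPL in
  obtain ⟨α, α', y, hα, -, hxα, hα', -, -, hy, rfl, rfl⟩ := hproj
  change ∃ h : (Program.fol Pr).sig.Sub (projectedProgram Pr R α α' u y).fol.sig,
    Set.BijOn (Interp.restrict h) {M : Interp (projectedProgram Pr R α α' u y).fol.sig D |
      M.IsModelSM (extendPreds p u) (projectedProgram Pr R α α' u y).fol} _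
  have hpreds : (projectedProgram Pr R α α' u y).fol.sig.preds =
    insert ⟨n, u⟩ Pr.fol.sig.preds := preds_fol_projectedProgram hR hα hα'
  have hfuns : (projectedProgram Pr R α α' u y).fol.sig.funs = Pr.fol.sig.funs :=
    funs_fol_projectedProgram hR hα hα'
  have h : (Program.fol Pr).sig.Sub (projectedProgram Pr R α α' u y).fol.sig :=
    ⟨hfuns.ge, hpreds ▸ Set.subset_insert _ _⟩
  have hmem : ⟨n, u⟩ ∈ (projectedProgram Pr R α α' u y).fol.sig.preds :=
    hpreds ▸ Set.mem_insert _ _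
  have hne : ∀ {m} {P : L.Relations m}, ⟨m, P⟩ ∈ Pr.fol.sig.preds →
      (⟨m, P⟩ : Σ n, L.Relations n) ≠ ⟨n, u⟩ := fun hP he => hu (he ▸ hP)
  refine ⟨h, fun M hM => ?_, fun M hM N hN hMN => ?_, fun M hM => ?_⟩
  · refine (Interp.isModelSM_iff_stable _ _ _).2
      (Program.stable_congr_structure (Interp.total_funMap_restrict h hfuns M) ?_)
    exact ((Interp.isModelSM_iff_stable _ _ _).1 hM).of_projectedProgram hu hR
      (fun hup => hu (hp _ hup)) hocc hα hα' hxα hy (Interp.rel_restrict h hpreds M)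
  -- Injectivity: both models interpret u by the projection, which depends only on their common
  -- restriction.
  · have hMu := ((Interp.isModelSM_iff_stable _ _ _).1 hM).eq_projection hu hR hocc hα hα' hxα hy
    have hNu := ((Interp.isModelSM_iff_stable _ _ _).1 hN).eq_projection hu hR hocc hα hα' hxα hy
    have hrel : ∀ m P, (⟨m, P⟩ : Σ n, L.Relations n) ≠ ⟨n, u⟩ → M.rel m P = N.rel m P :=
      fun m P hP => by
        rw [Interp.rel_restrict h hpreds M m P hP, hMN, ← Interp.rel_restrict h hpreds N m P hP]
    refine Interp.ext_of_eq (fun m f hf => ?_) fun m P hP => ?_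
    · have hf' : ⟨m, f⟩ ∈ Pr.fol.sig.funs := hfuns ▸ hf
      exact congrArg (fun K : Interp Pr.fol.sig D => K.fn f hf') hMN
    · rw [← Interp.rel_eq_pr hP, ← Interp.rel_eq_pr hP]
      by_cases hPu : (⟨m, P⟩ : Σ n, L.Relations n) = ⟨n, u⟩
      · cases hPu
        rw [hMu, hNu, projection_congr_of_ne hu hR hα hrel hrel]
        refine projection_congr (fun m f ds => ?_) (fun _ _ _ _ _ => rfl) fun _ _ _ _ _ => rfl
        rw [Interp.total_funMap_restrict h hfuns M, hMN,
          ← Interp.total_funMap_restrict h hfuns N]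
      · exact hrel m P hPu
  -- Surjectivity: M is expanded by the only possible value of u.
  · let Q := projection M.total M.rel M.rel α y
    let N : Interp (projectedProgram Pr R α α' u y).fol.sig D :=
      ⟨fun f hf => M.fn f (hfuns ▸ hf), fun {m} P _ => M.rel.set u Q m P⟩
    have hNM : N.restrict h = M := Interp.ext_of_eq (fun m f hf => rfl) fun m P hP =>
      (M.rel.set_of_ne u Q (hne hP)).trans (Interp.rel_eq_pr hP)
    have hrel : ∀ m P, (⟨m, P⟩ : Σ n, L.Relations n) ≠ ⟨n, u⟩ → N.rel m P = M.rel m P :=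
      fun m P hP => hNM ▸ Interp.rel_restrict h hpreds N m P hP
    have hfun : ∀ m (f : L.Functions m) ds, M.total.funMap f ds = N.total.funMap f ds :=
      fun m f ds => by rw [Interp.total_funMap_restrict h hfuns N, hNM]
    refine ⟨N, (Interp.isModelSM_iff_stable _ _ _).2 (Program.Stable.projectedProgram hu hR hocc
      hα hα' hxα hy hrel ?_ (Program.stable_congr_structure hfun
        ((Interp.isModelSM_iff_stable _ _ _).1 hM))), hNM⟩
    rw [Interp.rel_eq_pr hmem, projection_congr_of_ne hu hR hα hrel hrel]
    refine (M.rel.set_self u Q).trans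
      (projection_congr hfun (fun _ _ _ _ _ => rfl) fun _ _ _ _ _ => rfl)
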